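/- Let $K$ be a field of characteristic $0$ and let $L$ be a nonzero $K$-vector space (of arbitrary dimension) with a bilinear product $[\cdot,\cdot]$ and a linear bijection $\phi:L\to L$ such that $\phi([x,y])=[\phi(x),\phi(y)]$ and $$[[y,z],\phi(x)]=[[y,x],\phi(z)]+[\phi(y),[z,x]]\qquad\text{for all }x,y,z\in L$$ (a regular Hom-Leibniz algebra). For subspaces $S,T$ let $[S,T]$ be the span of all $[s,t]$, $s\in S$, $t\in T$. A subalgebra is a subspace $S$ with $[S,S]\subseteq S$ and $\phi(S)=S$; it is abelian if $[S,S]=0$. An ideal is a subspace $I$ with $[I,L]+[L,I]\subseteq I$ and $\phi(I)=I$. Let $J$ be the ideal generated by $\{[x,x]:x\in L\}$. $L$ is simple if its product is nonzero and its only ideals are $0,J,L$. $L$ is prime if, whenever ideals $I,M$ satisfy $[I,M]+[M,I]=0$, then $I\in\{0,J,L\}$ or $M\in\{0,J,L\}$. Let $H$ be a maximal abelian subalgebra of $L$. For $\alpha\in H^*$ put $L_\alpha=\{v\in L:[v,h]=\alpha(h)\phi(v)\ \text{for all }h\in H\}$, let $\Lambda=\{\alpha\in H^*\setminus\{0\}:L_\alpha\ne0\}$,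 and write $\alpha\phi^{-n}$ for $\alpha\circ(\phi|_H)^{-n}$. Suppose that $L$ is split, i.e. $L=H\oplus\bigoplus_{\alpha\in\Lambda}L_\alpha$, and of maximal length, i.e. $\dim L_\alpha=1$ for all $\alpha\in\Lambda$. Put $$\Lambda^J=\{\alpha\in\Lambda:L_\alpha\subseteq J\},\qquad \Lambda^{\neg J}=\{\alpha\in\Lambda:L_\alpha\cap J=0\}.$$ For $\Gamma\in\{\Lambda^J,\Lambda^{\neg J}\}$ and $\alpha,\beta\in\Gamma$, say that $\alpha$ is $\neg J$-connected to $\beta$ if there are $k\ge1$, $\alpha_1=\alpha\phi^{-n}$ with $n\in\mathbb N$, and $\alpha_2,\dots,\alpha_k\in\Lambda^{\neg J}$ such that, with $$s_1=\alpha_1,\qquad s_i=\alpha_1\phi^{-i+1}+\alpha_2\phi^{-i+1}+\alpha_3\phi^{-i+2}+\cdots+\alpha_i\phi^{-1}=\alpha_1\phi^{-i+1}+\sum_{j=2}^{i}\alpha_j\phi^{-i+j-1}\quad(2\le i\le k),$$ all of $s_1,\dots,s_k$ lie in $\Gamma$ and $s_k=\pm\beta\phi^{-m}$ for some sign and some $m\in\mathbb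 N$. (Here $0\in\mathbb N$.) Suppose further that: 1. $L=[L,L]$; 2. the Lie-annihilator is zero: with $W=H\oplus\bigoplus_{\alpha\in\Lambda^{\neg J}}L_\alpha$, the only $x\in L$ with $[x,W]+[W,x]=0$ is $x=0$; 3. $L$ is root-multiplicative: $[L_\alpha,L_\beta]\neq0$ whenever $\alpha,\beta\in\Lambda^{\neg J}$ and $\alpha\phi^{-1}+\beta\phi^{-1}\in\Lambda$; and $[L_\gamma,L_\alpha]\ne0$ whenever $\alpha\in\Lambda^{\neg J}$, $\gamma\in\Lambda^J$ and $\alpha\phi^{-1}+\gamma\phi^{-1}\in\Lambda^J$; 4. $\Lambda^J$ and $\Lambda^{\neg J}$ are symmetric, i.e. closed under $\alpha\mapsto-\alpha$. Then $L$ is simple if and only if $L$ is prime, any two roots in $\Lambda^J$ are $\neg J$-connected, and any two roots in $\Lambda^{\neg J}$ are $\neg J$-connected. -/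

import Mathlib

/-- A regular Hom-Leibniz algebra structure on the `K`-vector space `L`: a bilinear product and an
algebra automorphism `twist` (usually written `φ`) satisfying the (right) Hom-Leibniz identity
`[[y, z], φ x] = [[y, x], φ z] + [φ y, [z, x]]`. -/
structure RegularHomLeibniz (K L : Type*) [Field K] [AddCommGroup L] [Module K L] where
  bracket : L →ₗ[K] L →ₗ[K] L
  twist : L ≃ₗ[K] L
  twist_bracket : ∀ x y : L, twist (bracket x y) = bracket (twist x) (twist y)
  hom_leibniz : ∀ x y z : L,
    bracket (bracket y z) (twist x) =
      bracket (bracket y x) (twist z) + bracket (twist y) (bracket z x)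

namespace RegularHomLeibniz

variable {K L : Type*} [Field K] [AddCommGroup L] [Module K L] (A : RegularHomLeibniz K L)

/-- `[S, T]`, the subspace spanned by all products `[x, y]` with `x ∈ S` and `y ∈ T`. -/
def prod (S T : Submodule K L) : Submodule K L := Submodule.map₂ A.bracket S T

/-- Subalgebras are subspaces `S` with `[S, S] ⊆ S` and `φ(S) = S`. -/
def IsSubalgebra (S : Submodule K L) : Prop :=
  A.prod S S ≤ S ∧ S.map (A.twist : L →ₗ[K] L) = S

/-- Ideals are subspaces `I` with `[I, L] + [L, I] ⊆ I` and `φ(I) = I`. -/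
def IsIdeal (I : Submodule K L) : Prop :=
  A.prod I ⊤ ⊔ A.prod ⊤ I ≤ I ∧ I.map (A.twist : L →ₗ[K] L) = I

/-- `J`, the ideal generated by all squares `[x, x]`. -/
def squareIdeal : Submodule K L := sInf {I | A.IsIdeal I ∧ ∀ x : L, A.bracket x x ∈ I}

/-- The product is nonzero and the only ideals are `0`, `J` and `L`. -/
def IsSimple : Prop :=
  (∃ x y : L, A.bracket x y ≠ 0) ∧
    ∀ I : Submodule K L, A.IsIdeal I → I = ⊥ ∨ I = A.squareIdeal ∨ I = ⊤

/-- If two ideals satisfy `[I, M] + [M, I] = 0`, then one of them is `0`, `J` or `L`. -/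
def IsPrime : Prop :=
  ∀ I M : Submodule K L, A.IsIdeal I → A.IsIdeal M → A.prod I M ⊔ A.prod M I = ⊥ →
    (I = ⊥ ∨ I = A.squareIdeal ∨ I = ⊤) ∨ (M = ⊥ ∨ M = A.squareIdeal ∨ M = ⊤)

/-- `L = [L, L]`. -/
def IsPerfect : Prop := A.prod ⊤ ⊤ = ⊤

/-- `H` is maximal among the abelian subalgebras. -/
def IsMaximalAbelianSubalgebra (H : Submodule K L) : Prop :=
  Maximal (fun S : Submodule K L => A.IsSubalgebra S ∧ A.prod S S = ⊥) H

/-- `L_α = {v | [v, h] = α(h) φ(v) for all h ∈ H}`, for a linear functional `α` on `H`. -/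
def rootSpace (H : Submodule K L) (α : Module.Dual K H) : Submodule K L where
  carrier := {v | ∀ h : H, A.bracket v (h : L) = α h • A.twist v}
  add_mem' := by
    intro v w hv hw h
    simp [hv h, hw h]
  zero_mem' := by
    intro h
    simp
  smul_mem' := by
    intro c v hv h
    simp [hv h, smul_comm c]

/-- `Λ`, the set of nonzero functionals `α` on `H` with `L_α ≠ 0`. -/
def roots (H : Submodule K L) : Set (Module.Dual K H) := {α | α ≠ 0 ∧ A.rootSpace H α ≠ ⊥}

/-- The summands of the root decomposition: `H` (at `none`) and the `L_α` with `α ∈ Λ`. -/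
def rootSummand (H : Submodule K L) : Option (A.roots H) → Submodule K L
  | none => H
  | some α => A.rootSpace H α

end RegularHomLeibniz

/-- A split regular Hom-Leibniz algebra: a regular Hom-Leibniz algebra with a maximal abelian
subalgebra `H` such that `L` is the direct sum of `H` and of the root spaces `L_α`, `α ∈ Λ`. -/
structure SplitRegularHomLeibniz (K L : Type*) [Field K] [AddCommGroup L] [Module K L] extends
    RegularHomLeibniz K L where
  H : Submodule K L
  maximal_H : toRegularHomLeibniz.IsMaximalAbelianSubalgebra H
  independent : iSupIndep (toRegularHomLeibniz.rootSummand H)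
  spanning : ⨆ i, toRegularHomLeibniz.rootSummand H i = ⊤

namespace SplitRegularHomLeibniz

variable {K L : Type*} [Field K] [AddCommGroup L] [Module K L] (S : SplitRegularHomLeibniz K L)

/-- The restriction of `φ` to `H`. -/
def twistH : S.H ≃ₗ[K] S.H := S.twist.ofSubmodules S.H S.H S.maximal_H.1.1.2

/-- The map `α ↦ α φ⁻¹` on linear functionals on `H`; its `n`-th iterate is `α ↦ α φ⁻ⁿ`. -/
def shift (α : Module.Dual K S.H) : Module.Dual K S.H := α ∘ₗ (S.twistH.symm : S.H →ₗ[K] S.H)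

/-- The root space `L_α`. -/
abbrev L_ (α : Module.Dual K S.H) : Submodule K L := S.rootSpace S.H α

/-- `Λ`, the set of (nonzero) roots. -/
abbrev Λ : Set (Module.Dual K S.H) := S.roots S.H

/-- `Λ^J`. -/
def rootsJ : Set (Module.Dual K S.H) := {α | α ∈ S.Λ ∧ S.L_ α ≤ S.squareIdeal}

/-- `Λ^{¬J}`. -/
def rootsNotJ : Set (Module.Dual K S.H) := {α | α ∈ S.Λ ∧ S.L_ α ⊓ S.squareIdeal = ⊥}

/-- A set of roots is symmetric if it is closed under `α ↦ -α`. -/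
def IsSymmetric (Γ : Set (Module.Dual K S.H)) : Prop := ∀ α ∈ Γ, -α ∈ Γ

/-- All root spaces `L_α`, `α ∈ Λ`, are one-dimensional. -/
def IsMaximalLength : Prop := ∀ α ∈ S.Λ, Module.finrank K (S.L_ α) = 1

/-- The subspace `H ⊕ ⨁_{α ∈ Λ^{¬J}} L_α`. -/
def liePart : Submodule K L := S.H ⊔ ⨆ α ∈ S.rootsNotJ, S.L_ α

/-- The Lie-annihilator `{x | [x, W] + [W, x] = 0}` for `W = H ⊕ ⨁_{α ∈ Λ^{¬J}} L_α`. -/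
def lieAnnihilator : Submodule K L where
  carrier := {x | ∀ y ∈ S.liePart, S.bracket x y = 0 ∧ S.bracket y x = 0}
  add_mem' := by
    intro a b ha hb y hy
    simp [ha y hy, hb y hy]
  zero_mem' := by
    intro y _
    simp
  smul_mem' := by
    intro c a ha y hy
    simp [ha y hy]

/-- Root-multiplicativity. In the second condition the root vector of `Λ^J` is the left factor:
products with an element of `J` as the right factor are always zero. -/
def IsRootMultiplicative : Prop :=
  (∀ α ∈ S.rootsNotJ, ∀ β ∈ S.rootsNotJ, S.shift α + S.shift β ∈ S.Λ →
    S.prod (S.L_ α) (S.L_ β) ≠ ⊥) ∧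
  (∀ α ∈ S.rootsNotJ, ∀ γ ∈ S.rootsJ, S.shift α + S.shift γ ∈ S.rootsJ →
    S.prod (S.L_ γ) (S.L_ α) ≠ ⊥)

/-- For a sequence `a 1, a 2, …` and `i ≥ 1`, the functional
`a₁ φ^{-i+1} + a₂ φ^{-i+1} + a₃ φ^{-i+2} + ⋯ + a_j φ^{-i+j-1} + ⋯ + a_i φ^{-1}`
(which is `a₁` for `i = 1`). -/
def partialSum (a : ℕ → Module.Dual K S.H) (i : ℕ) : Module.Dual K S.H :=
  S.shift^[i - 1] (a 1) + ∑ j ∈ Finset.Icc 2 i, S.shift^[i - j + 1] (a j)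

/-- `α` is `¬J`-connected to `β`, for `α, β ∈ Γ`, where `Γ` is `Λ^J` or `Λ^{¬J}`. -/
def IsNotJConnected (Γ : Set (Module.Dual K S.H)) (α β : Module.Dual K S.H) : Prop :=
  ∃ (k : ℕ) (a : ℕ → Module.Dual K S.H), 1 ≤ k ∧
    (∀ i ∈ Finset.Icc 2 k, a i ∈ S.rootsNotJ) ∧
    (∀ i ∈ Finset.Icc 1 k, S.partialSum a i ∈ Γ) ∧
    (∃ n : ℕ, a 1 = S.shift^[n] α) ∧
    (∃ m : ℕ, S.partialSum a k = S.shift^[m] β ∨ S.partialSum a k = -(S.shift^[m] β))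

/-- `Γ` (which is `Λ^J` or `Λ^{¬J}`) has all of its roots `¬J`-connected. -/
def AllNotJConnected (Γ : Set (Module.Dual K S.H)) : Prop :=
  ∀ α ∈ Γ, ∀ β ∈ Γ, S.IsNotJConnected Γ α β

end SplitRegularHomLeibniz

/-!
Write `J` for the ideal generated by the squares. Polarising a square shows `[x, y] + [y, x] ∈ J`,
and the Hom-Leibniz identity gives `[L, J] = 0`; hence `J ≠ L` when `L = [L, L] ≠ 0`.

The vectors in `L_α` are joint eigenvectors of the operators `v ↦ φ⁻¹ [v, h]`, `h ∈ H`, and ideals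
are stable under these operators, so ideals are graded by the weights (`mem_of_sum_mem`). Moreover
`L_0 = H`, `φ (L_α) = L_{αφ⁻¹}` and `[L_α, L_β] ⊆ L_{(α + β)φ⁻¹}`. As root spaces are lines, each root
lies in exactly one of `Λ^J` and `Λ^{¬J}`, and an ideal is determined by the root spaces it contains
and its intersection with `H`. An ideal without a root space from `Λ^{¬J}` meets `H` in the
Lie-annihilator, that is, in `0` (`H_inf_eq_bot`), so it lies in `J`, which is itself the sum of the
`L_α` with `α ∈ Λ^J`.

The functionals in a connection satisfy `s_{i+1} = (s_i + α_{i+1}) φ⁻¹` (`partialSum_succ`), so a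
connection is a walk whose steps follow products of root vectors with right factors in `Λ^{¬J}`.

If `L` is simple, consider the connection class `C` of a root. When `C ⊆ Λ^J`, the sum of the `L_β`
with `β ∈ C` is a nonzero ideal in `J` (`isIdeal_sumL`), hence equal to `J`. When `C ⊆ Λ^{¬J}`, the sum of
`J`, the `L_β` and the `[L_β, L_{-β}]` is an ideal not contained in `J` (`exists_isIdeal`), hence equal
to `L`. In both cases `C` is everything.

Conversely, let `I` be an ideal. If it contains `L_α` for some `α ∈ Λ^{¬J}`, then root-multiplicativity
carries this along connections, so `I` contains one of `L_γ`, `L_{-γ}` for every `γ ∈ Λ^{¬J}`. Because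
`L = [L, L]`, this forces `H ⊆ I` and then `I = L` (`eq_top_of_forall_L_le_or`). Otherwise `I ⊆ J`; by
root-multiplicativity and symmetry the root spaces of `J` outside `I` span an ideal complementary to
`I` in `J`, and primeness yields `I = 0` or `I = J` (`eq_bot_or_eq_squareIdeal`).
-/

/-! ### Ideals and squares -/

namespace RegularHomLeibniz

variable {K L : Type*} [Field K] [AddCommGroup L] [Module K L] (A : RegularHomLeibniz K L)

theorem isIdeal_iff {I : Submodule K L} :
    A.IsIdeal I ↔ (∀ x ∈ I, ∀ y, A.bracket x y ∈ I ∧ A.bracket y x ∈ I) ∧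
      ∀ x, A.twist x ∈ I ↔ x ∈ I := by
  unfold IsIdeal prod
  rw [sup_le_iff, Submodule.map₂_le, Submodule.map₂_le]
  refine and_congr ⟨fun h x hx y => ⟨h.1 x hx y trivial, h.2 y trivial x hx⟩,
    fun h => ⟨fun x hx y _ => (h x hx y).1, fun y _ x hx => (h x hx y).2⟩⟩ ⟨?_, ?_⟩
  · intro h x
    constructor
    · intro hx
      rw [← h] at hx
      obtain ⟨y, hy, hyx⟩ := hx
      rwa [← A.twist.injective hyx]
    · intro hx
      rw [← h]
      exact ⟨x, hx, rfl⟩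
  · intro h
    ext x
    constructor
    · rintro ⟨y, hy, rfl⟩
      exact (h y).2 hy
    · intro hx
      exact ⟨A.twist.symm x, (h _).1 (by simpa using hx), by simp⟩

variable {A}

theorem IsIdeal.bracket_left {I : Submodule K L} (hI : A.IsIdeal I) {x : L} (hx : x ∈ I) (y : L) :
    A.bracket x y ∈ I := ((A.isIdeal_iff.1 hI).1 x hx y).1

theorem IsIdeal.bracket_right {I : Submodule K L} (hI : A.IsIdeal I) {x : L} (hx : x ∈ I) (y : L) :
    A.bracket y x ∈ I := ((A.isIdeal_iff.1 hI).1 x hx y).2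

theorem IsIdeal.twist_mem_iff {I : Submodule K L} (hI : A.IsIdeal I) {x : L} :
    A.twist x ∈ I ↔ x ∈ I := (A.isIdeal_iff.1 hI).2 x

theorem prod_eq_bot_iff {V W : Submodule K L} :
    A.prod V W = ⊥ ↔ ∀ x ∈ V, ∀ y ∈ W, A.bracket x y = 0 := by
  rw [eq_bot_iff, prod, Submodule.map₂_le]
  simp

theorem isIdeal_squareIdeal : A.IsIdeal A.squareIdeal := by
  rw [isIdeal_iff]
  simp only [squareIdeal, Submodule.mem_sInf]
  refine ⟨fun x hx y => ⟨fun I hI => hI.1.bracket_left (hx I hI) y,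
    fun I hI => hI.1.bracket_right (hx I hI) y⟩, fun x => ?_⟩
  exact forall₂_congr fun I hI => hI.1.twist_mem_iff

theorem bracket_self_mem_squareIdeal (x : L) : A.bracket x x ∈ A.squareIdeal := by
  simp only [squareIdeal, Submodule.mem_sInf]
  exact fun I hI => hI.2 x

theorem bracket_add_swap_mem_squareIdeal (x y : L) :
    A.bracket x y + A.bracket y x ∈ A.squareIdeal := by
  have h := A.squareIdeal.sub_mem (bracket_self_mem_squareIdeal (A := A) (x + y))
    (A.squareIdeal.add_mem (bracket_self_mem_squareIdeal (A := A) x)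
      (bracket_self_mem_squareIdeal (A := A) y))
  simp only [map_add, LinearMap.add_apply] at h
  convert h using 1
  abel

/-- Products with a right factor in `J` vanish: the Hom-Leibniz identity shows that
`{v | [L, v] = 0}` is an ideal which contains all squares. -/
theorem bracket_eq_zero_of_mem_squareIdeal (x : L) {y : L} (hy : y ∈ A.squareIdeal) :
    A.bracket x y = 0 := by
  let R : Submodule K L := LinearMap.ker A.bracket.flip
  have hR : ∀ v, v ∈ R ↔ ∀ u, A.bracket u v = 0 := fun v => by
    simp [R, LinearMap.ext_iff]
  have htw : ∀ v, A.twist v ∈ R ↔ v ∈ R := fun v => by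
    rw [hR, hR, A.twist.surjective.forall]
    simp [← A.twist_bracket]
  refine (hR y).1 ?_ x
  refine (Submodule.mem_sInf.1 hy) R ⟨A.isIdeal_iff.2 ⟨fun v hv u => ⟨?_, ?_⟩, htw⟩, fun v => ?_⟩
  · rw [hR, A.twist.surjective.forall]
    intro w
    have h := A.hom_leibniz u w v
    rwa [(hR v).1 hv w, map_zero, LinearMap.zero_apply, (hR _).1 ((htw v).2 hv), zero_add,
      eq_comm] at h
  · rw [(hR v).1 hv u]
    exact R.zero_mem
  · rw [hR, A.twist.surjective.forall]
    intro w
    simpa using A.hom_leibniz v w v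

/-- Root vectors, of possibly different weights, are joint eigenvectors of the operators
`v ↦ φ⁻¹ [v, h]`; a subspace stable under these operators contains with a sum of root vectors of
pairwise distinct weights each of its terms. -/
theorem mem_of_sum_mem {H I : Submodule K L} (hI : ∀ x ∈ I, ∀ h ∈ H, A.bracket x h ∈ I)
    (hφ : ∀ x, A.twist x ∈ I ↔ x ∈ I) (s : Finset (Module.Dual K H)) :
    ∀ x : Module.Dual K H → L, (∀ α ∈ s, x α ∈ A.rootSpace H α) → ∑ α ∈ s, x α ∈ I →
      ∀ α ∈ s, x α ∈ I := by
  classical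
  induction s using Finset.induction_on with
  | empty => simp
  | insert β s hβ ih =>
    intro x hx hsum
    have key : ∀ α ∈ s, x α ∈ I := by
      intro α hα
      obtain ⟨h, hh⟩ : ∃ h, α h ≠ β h := by
        by_contra! hc
        exact hβ (LinearMap.ext hc ▸ hα)
      -- the operator `φ⁻¹ [·, h] - β h` removes the term at `β` and rescales the others
      have hmem : ∑ γ ∈ s, (γ h - β h) • x γ ∈ I := by
        rw [← hφ]
        have h1 := I.sub_mem (hI _ hsum h h.2) (I.smul_mem (β h) ((hφ _).2 hsum))
        have h2 : A.bracket (x β) h = β h • A.twist (x β) := hx β (Finset.mem_insert_self _ _) h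
        have h3 : ∀ γ ∈ s, A.bracket (x γ) h = γ h • A.twist (x γ) :=
          fun γ hγ => hx γ (Finset.mem_insert_of_mem hγ) h
        rw [Finset.sum_insert hβ, map_add, map_add, LinearMap.add_apply, h2, smul_add,
          add_sub_add_left_eq_sub, map_sum, map_sum, LinearMap.sum_apply, Finset.sum_congr rfl h3,
          Finset.smul_sum, ← Finset.sum_sub_distrib] at h1
        simpa only [map_sum, map_smul, sub_smul, map_sub] using h1
      have := ih (fun γ => (γ h - β h) • x γ)
        (fun γ hγ => Submodule.smul_mem _ _ (hx γ (Finset.mem_insert_of_mem hγ))) hmem α hα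
      exact (I.smul_mem_iff (sub_ne_zero.2 hh)).1 this
    intro α hα
    rcases Finset.mem_insert.1 hα with rfl | hα
    · rw [Finset.sum_insert hβ] at hsum
      exact (I.add_mem_iff_left (I.sum_mem key)).1 hsum
    · exact key α hα

end RegularHomLeibniz

namespace SplitRegularHomLeibniz

open RegularHomLeibniz

variable {K L : Type*} [Field K] [AddCommGroup L] [Module K L] (S : SplitRegularHomLeibniz K L)

/-! ### The grading by weights -/

theorem shift_add (α β : Module.Dual K S.H) : S.shift (α + β) = S.shift α + S.shift β :=
  LinearMap.add_comp _ _ _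

theorem shift_neg (α : Module.Dual K S.H) : S.shift (-α) = -S.shift α := LinearMap.neg_comp _ _

theorem shift_zero : S.shift 0 = 0 := LinearMap.zero_comp _

theorem shift_sum {ι : Type*} (s : Finset ι) (f : ι → Module.Dual K S.H) :
    S.shift (∑ i ∈ s, f i) = ∑ i ∈ s, S.shift (f i) :=
  map_sum S.twistH.symm.dualMap f s

theorem shift_injective : Function.Injective S.shift := S.twistH.symm.dualMap.injective

theorem shift_surjective : Function.Surjective S.shift := S.twistH.symm.dualMap.surjective

theorem shift_eq_zero_iff {α : Module.Dual K S.H} : S.shift α = 0 ↔ α = 0 := by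
  rw [← S.shift_zero, S.shift_injective.eq_iff, S.shift_zero]

theorem shift_apply_twistH (α : Module.Dual K S.H) (h : S.H) : S.shift α (S.twistH h) = α h := by
  simp [shift]

theorem shift_iterate_neg (n : ℕ) (α : Module.Dual K S.H) :
    S.shift^[n] (-α) = -S.shift^[n] α := by
  induction n generalizing α with
  | zero => rfl
  | succ n ih => simp only [Function.iterate_succ_apply, shift_neg, ih]

theorem shift_iterate_add (n : ℕ) (α β : Module.Dual K S.H) :
    S.shift^[n] (α + β) = S.shift^[n] α + S.shift^[n] β := by
  induction n generalizing α β with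
  | zero => rfl
  | succ n ih => simp only [Function.iterate_succ_apply, shift_add, ih]

variable {S}

theorem twist_mem_L_iff {α : Module.Dual K S.H} {v : L} :
    S.twist v ∈ S.L_ (S.shift α) ↔ v ∈ S.L_ α := by
  change (∀ h : S.H, _) ↔ ∀ h : S.H, _
  rw [S.twistH.surjective.forall]
  refine forall_congr' fun h => ?_
  rw [S.shift_apply_twistH]
  change S.bracket (S.twist v) (S.twist h) = _ ↔ _
  rw [← S.twist_bracket, ← map_smul, S.twist.injective.eq_iff]

theorem L_le_iff {I : Submodule K L} (hI : ∀ x, S.twist x ∈ I ↔ x ∈ I) (α : Module.Dual K S.H) :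
    S.L_ (S.shift α) ≤ I ↔ S.L_ α ≤ I := by
  constructor
  · exact fun h v hv => (hI v).1 (h (twist_mem_L_iff.2 hv))
  · intro h v hv
    obtain ⟨w, rfl⟩ := S.twist.surjective v
    exact (hI w).2 (h (twist_mem_L_iff.1 hv))

theorem bracket_mem_L {α β : Module.Dual K S.H} {v w : L} (hv : v ∈ S.L_ α) (hw : w ∈ S.L_ β) :
    S.bracket v w ∈ S.L_ (S.shift (α + β)) := by
  change ∀ h : S.H, _
  rw [S.twistH.surjective.forall]
  intro h
  rw [S.shift_apply_twistH]
  change S.bracket _ (S.twist h) = _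
  rw [S.hom_leibniz, hv h, hw h, S.twist_bracket]
  simp [add_smul]

theorem bracket_eq_zero_of_mem_H {x y : L} (hx : x ∈ S.H) (hy : y ∈ S.H) : S.bracket x y = 0 :=
  prod_eq_bot_iff.1 S.maximal_H.1.2 x hx y hy

theorem mem_L_zero_of_mem_H {x : L} (hx : x ∈ S.H) : x ∈ S.L_ 0 := fun h => by
  simp [bracket_eq_zero_of_mem_H hx h.2]

variable (S) in
/-- The sum of the root spaces `L_α` with `α ∈ Γ`. -/
def sumL (Γ : Set (Module.Dual K S.H)) : Submodule K L := ⨆ α ∈ Γ, S.L_ α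

theorem L_le_sumL {Γ : Set (Module.Dual K S.H)} {α} (hα : α ∈ Γ) : S.L_ α ≤ S.sumL Γ :=
  le_biSup S.L_ hα

theorem exists_sum_of_mem_sumL {Γ : Set (Module.Dual K S.H)} {w : L} (hw : w ∈ S.sumL Γ) :
    ∃ (s : Finset (Module.Dual K S.H)) (x : Module.Dual K S.H → L),
      (∀ α ∈ s, α ∈ Γ ∧ x α ∈ S.L_ α) ∧ ∑ α ∈ s, x α = w := by
  obtain ⟨f, hf, rfl⟩ := (Submodule.mem_iSup_iff_exists_finsupp _ _).1 hw
  refine ⟨f.support, f, fun α hα => ?_, rfl⟩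
  by_cases hΓ : α ∈ Γ
  · exact ⟨hΓ, by simpa [hΓ] using hf α⟩
  · have := hf α
    simp only [hΓ, iSup_false, Submodule.mem_bot] at this
    exact absurd this (Finsupp.mem_support_iff.1 hα)

theorem mem_of_add_mem {I : Submodule K L} (hI : ∀ x ∈ I, ∀ h ∈ S.H, S.bracket x h ∈ I)
    (hφ : ∀ x, S.twist x ∈ I ↔ x ∈ I) {Γ : Set (Module.Dual K S.H)} {α : Module.Dual K S.H}
    (hα : α ∉ Γ) {v w : L} (hv : v ∈ S.L_ α) (hw : w ∈ S.sumL Γ) (hvw : v + w ∈ I) : v ∈ I := by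
  classical
  obtain ⟨s, x, hx, rfl⟩ := exists_sum_of_mem_sumL hw
  have hs : α ∉ s := fun h => hα (hx α h).1
  have hne : ∀ β ∈ s, β ≠ α := fun β hβ h => hs (h ▸ hβ)
  have := mem_of_sum_mem (A := S.toRegularHomLeibniz) hI hφ (insert α s) (Function.update x α v)
    (fun β hβ => ?_) ?_ α (Finset.mem_insert_self _ _)
  · simpa using this
  · rcases Finset.mem_insert.1 hβ with rfl | hβ
    · simpa using hv
    · simpa [Function.update_of_ne (hne β hβ)] using (hx β hβ).2
  · rw [Finset.sum_insert hs, Function.update_self,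
      Finset.sum_congr rfl fun β hβ => Function.update_of_ne (hne β hβ) v x]
    exact hvw

theorem disjoint_L_sumL {Γ : Set (Module.Dual K S.H)} {α : Module.Dual K S.H} (hα : α ∉ Γ) :
    Disjoint (S.L_ α) (S.sumL Γ) := by
  rw [Submodule.disjoint_def]
  intro v hv hw
  refine (Submodule.mem_bot K).1 (mem_of_add_mem (I := ⊥) ?_ ?_ hα hv (neg_mem hw) (by simp))
  · simp
  · simp

theorem H_sup_sumL_roots : S.H ⊔ S.sumL S.Λ = ⊤ := by
  rw [eq_top_iff, ← S.spanning, iSup_le_iff]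
  rintro (_ | ⟨α, hα⟩)
  · exact le_sup_left
  · exact (L_le_sumL hα).trans le_sup_right

theorem L_zero : S.L_ 0 = S.H := by
  refine le_antisymm (fun v hv => ?_) fun x => mem_L_zero_of_mem_H
  obtain ⟨h, hh, w, hw, rfl⟩ :=
    Submodule.mem_sup.1 ((H_sup_sumL_roots (S := S)).ge (Submodule.mem_top (x := v)))
  have hw0 : w ∈ S.L_ 0 := by simpa using sub_mem hv (mem_L_zero_of_mem_H hh)
  have : w = 0 := Submodule.disjoint_def.1
    (disjoint_L_sumL (S := S) (Γ := S.Λ) (α := 0) fun h => h.1 rfl) w hw0 hw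
  simpa [this] using hh

theorem L_eq_bot {α : Module.Dual K S.H} (h0 : α ≠ 0) (h : α ∉ S.Λ) : S.L_ α = ⊥ := by
  by_contra hc
  exact h ⟨h0, hc⟩

theorem sumL_univ : S.sumL Set.univ = ⊤ := by
  rw [eq_top_iff, ← H_sup_sumL_roots (S := S), sup_le_iff]
  refine ⟨L_zero.ge.trans (L_le_sumL (Set.mem_univ 0)), ?_⟩
  exact iSup₂_le fun α _ => L_le_sumL (Set.mem_univ α)

/-- To prove a linear property of all elements of `L`, it suffices to treat weight vectors. -/
theorem eq_top_of_forall_L_le {P : Submodule K L} (h : ∀ α, S.L_ α ≤ P) : P = ⊤ := by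
  rw [eq_top_iff, ← sumL_univ (S := S)]
  exact iSup₂_le fun α _ => h α

theorem shift_mem_roots_iff {α : Module.Dual K S.H} : S.shift α ∈ S.Λ ↔ α ∈ S.Λ := by
  refine and_congr S.shift_eq_zero_iff.not (not_congr ?_)
  have := L_le_iff (S := S) (I := ⊥) (by simp) α
  rwa [le_bot_iff, le_bot_iff] at this

theorem shift_mem_rootsJ_iff {α : Module.Dual K S.H} : S.shift α ∈ S.rootsJ ↔ α ∈ S.rootsJ :=
  and_congr shift_mem_roots_iff
    (L_le_iff (fun _ => (isIdeal_squareIdeal (A := S.toRegularHomLeibniz)).twist_mem_iff) α)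

theorem shift_mem_rootsNotJ_iff {α : Module.Dual K S.H} :
    S.shift α ∈ S.rootsNotJ ↔ α ∈ S.rootsNotJ := by
  refine and_congr shift_mem_roots_iff ?_
  rw [← disjoint_iff, ← disjoint_iff, Submodule.disjoint_def, Submodule.disjoint_def,
    S.twist.surjective.forall]
  refine forall_congr' fun v => ?_
  rw [twist_mem_L_iff, (isIdeal_squareIdeal (A := S.toRegularHomLeibniz)).twist_mem_iff,
    LinearEquiv.map_eq_zero_iff]

/-! ### Root spaces of dimension one -/

theorem L_le_of_mem (hlen : S.IsMaximalLength) {α : Module.Dual K S.H} (hα : α ∈ S.Λ)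
    {I : Submodule K L} {v : L} (hv : v ∈ S.L_ α) (h0 : v ≠ 0) (hI : v ∈ I) : S.L_ α ≤ I := by
  intro w hw
  obtain ⟨c, hc⟩ := (finrank_eq_one_iff_of_nonzero' (⟨v, hv⟩ : S.L_ α) (by simpa using h0)).1
    (hlen α hα) ⟨w, hw⟩
  rw [← show c • v = w from congrArg Subtype.val hc]
  exact I.smul_mem c hI

theorem mem_rootsJ_or_mem_rootsNotJ (hlen : S.IsMaximalLength) {α : Module.Dual K S.H}
    (hα : α ∈ S.Λ) : α ∈ S.rootsJ ∨ α ∈ S.rootsNotJ := by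
  by_cases h : S.L_ α ⊓ S.squareIdeal = ⊥
  · exact .inr ⟨hα, h⟩
  · obtain ⟨v, hv, h0⟩ := Submodule.exists_mem_ne_zero_of_ne_bot h
    exact .inl ⟨hα, L_le_of_mem hlen hα hv.1 h0 hv.2⟩

theorem notMem_rootsNotJ_of_mem_rootsJ {α : Module.Dual K S.H} (hα : α ∈ S.rootsJ) :
    α ∉ S.rootsNotJ := fun h => by
  have := h.2
  rw [inf_eq_left.2 hα.2] at this
  exact hα.1.2 this

theorem L_cases (hlen : S.IsMaximalLength) {α : Module.Dual K S.H} :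
    S.L_ α = ⊥ ∨ α = 0 ∨ α ∈ S.rootsJ ∨ α ∈ S.rootsNotJ := by
  by_cases h0 : α = 0
  · exact .inr (.inl h0)
  by_cases h : α ∈ S.Λ
  · exact .inr (.inr (mem_rootsJ_or_mem_rootsNotJ hlen h))
  · exact .inl (L_eq_bot h0 h)

theorem L_shift_add_le (hlen : S.IsMaximalLength) {α β : Module.Dual K S.H} {I : Submodule K L}
    (hI : S.IsIdeal I) (hα : S.L_ α ≤ I) (h : S.shift (α + β) ∈ S.Λ)
    (hne : S.prod (S.L_ α) (S.L_ β) ≠ ⊥) : S.L_ (S.shift (α + β)) ≤ I := by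
  rw [Ne, prod_eq_bot_iff] at hne
  push Not at hne
  obtain ⟨x, hx, y, hy, hxy⟩ := hne
  exact L_le_of_mem hlen h (bracket_mem_L hx hy) hxy (hI.bracket_left (hα hx) y)

/-! ### Ideals are graded -/

/-- A subspace spanned by a set `G` is an ideal as soon as the ideal conditions hold for `G` and
for weight vectors. -/
theorem isIdeal_span {G : Set L} (hG : ∀ g ∈ G, ∀ α, ∀ v ∈ S.L_ α,
      S.bracket g v ∈ Submodule.span K G ∧ S.bracket v g ∈ Submodule.span K G)
    (h1 : ∀ g ∈ G, S.twist g ∈ Submodule.span K G)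
    (h2 : ∀ g ∈ G, S.twist.symm g ∈ Submodule.span K G) : S.IsIdeal (Submodule.span K G) := by
  set I := Submodule.span K G
  refine S.isIdeal_iff.2 ⟨fun x hx y => ?_, fun x => ⟨fun hx => ?_, fun hx => ?_⟩⟩
  · let P : Submodule K L := I.comap (S.bracket x) ⊓ I.comap (S.bracket.flip x)
    suffices P = ⊤ from (this ▸ Submodule.mem_top : y ∈ P)
    refine eq_top_of_forall_L_le (S := S) fun α v hv => ?_
    have : I ≤ I.comap (S.bracket.flip v) ⊓ I.comap (S.bracket v) :=
      Submodule.span_le.2 fun g hg => hG g hg α v hv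
    exact this hx
  · have : I ≤ I.comap (S.twist.symm : L →ₗ[K] L) := Submodule.span_le.2 h2
    simpa using this hx
  · have : I ≤ I.comap (S.twist : L →ₗ[K] L) := Submodule.span_le.2 h1
    exact this hx

theorem le_sumL_of_isIdeal {I : Submodule K L} (hI : S.IsIdeal I) {Γ : Set (Module.Dual K S.H)}
    (h : ∀ α ∉ Γ, S.L_ α ⊓ I = ⊥) : I ≤ S.sumL Γ := by
  intro x hx
  obtain ⟨s, f, hf, rfl⟩ :=
    exists_sum_of_mem_sumL ((sumL_univ (S := S)).ge (Submodule.mem_top (x := x)))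
  refine sum_mem fun α hα => ?_
  have hαI := mem_of_sum_mem (A := S.toRegularHomLeibniz) (fun x hx h _ => hI.bracket_left hx h)
    (fun x => hI.twist_mem_iff) s f (fun α hα => (hf α hα).2) hx α hα
  by_cases hΓ : α ∈ Γ
  · exact L_le_sumL hΓ (hf α hα).2
  · have : f α ∈ S.L_ α ⊓ I := ⟨(hf α hα).2, hαI⟩
    rw [h α hΓ, Submodule.mem_bot] at this
    rw [this]
    exact zero_mem _

theorem bracket_left_of_mem_rootsNotJ {α : Module.Dual K S.H} (hα : α ∈ S.rootsNotJ) {v h : L}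
    (hv : v ∈ S.L_ α) (hh : h ∈ S.H) : S.bracket h v = -S.bracket v h := by
  have h1 : S.bracket h v + S.bracket v h ∈ S.L_ (S.shift α) :=
    add_mem (by simpa using bracket_mem_L (mem_L_zero_of_mem_H hh) hv)
      (by simpa using bracket_mem_L hv (mem_L_zero_of_mem_H hh))
  have h2 : S.bracket h v + S.bracket v h ∈ S.L_ (S.shift α) ⊓ S.squareIdeal :=
    ⟨h1, bracket_add_swap_mem_squareIdeal h v⟩
  rw [(shift_mem_rootsNotJ_iff.2 hα).2, Submodule.mem_bot] at h2
  exact eq_neg_of_add_eq_zero_left h2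

/-- An ideal without root spaces outside `J` meets `H` trivially, because every element of the
intersection lies in the Lie-annihilator. -/
theorem H_inf_eq_bot (hlen : S.IsMaximalLength) (hann : S.lieAnnihilator = ⊥) {I : Submodule K L}
    (hI : S.IsIdeal I) (h : ∀ α ∈ S.rootsNotJ, ¬ S.L_ α ≤ I) : S.H ⊓ I = ⊥ := by
  rw [eq_bot_iff, ← hann]
  rintro x ⟨hxH, hxI⟩
  let P : Submodule K L := LinearMap.ker (S.bracket x) ⊓ LinearMap.ker (S.bracket.flip x)
  suffices S.liePart ≤ P from fun y hy => this hy
  refine sup_le (fun y hy => ⟨bracket_eq_zero_of_mem_H hxH hy, bracket_eq_zero_of_mem_H hy hxH⟩)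
    (iSup₂_le fun α hα v hv => ?_)
  have hvx : S.bracket v x = 0 := by
    by_contra hne
    have h1 : S.bracket v x ∈ S.L_ (S.shift α) := by
      simpa using bracket_mem_L hv (mem_L_zero_of_mem_H hxH)
    refine h α hα ((L_le_iff (fun x => hI.twist_mem_iff) α).1 ?_)
    exact L_le_of_mem hlen (shift_mem_roots_iff.2 hα.1) h1 hne (hI.bracket_right hxI v)
  exact ⟨by simp [bracket_left_of_mem_rootsNotJ hα hv hxH, hvx], hvx⟩

theorem L_inf_eq_bot_of_not_le (hlen : S.IsMaximalLength) {α : Module.Dual K S.H} (hα : α ∈ S.Λ)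
    {I : Submodule K L} (h : ¬ S.L_ α ≤ I) : S.L_ α ⊓ I = ⊥ := by
  by_contra hne
  obtain ⟨v, hv, h0⟩ := Submodule.exists_mem_ne_zero_of_ne_bot hne
  exact h (L_le_of_mem hlen hα hv.1 h0 hv.2)

theorem le_sumL_of_not_le (hlen : S.IsMaximalLength) (hann : S.lieAnnihilator = ⊥)
    {I : Submodule K L} (hI : S.IsIdeal I) (h : ∀ α ∈ S.rootsNotJ, ¬ S.L_ α ≤ I) :
    I ≤ S.sumL {α | α ∈ S.rootsJ ∧ S.L_ α ≤ I} := by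
  refine le_sumL_of_isIdeal hI fun α hα => ?_
  rcases L_cases hlen (α := α) with h0 | rfl | hJ | hN
  · simp [h0]
  · rw [L_zero, H_inf_eq_bot hlen hann hI h]
  · exact L_inf_eq_bot_of_not_le hlen hJ.1 fun hle => hα ⟨hJ, hle⟩
  · exact L_inf_eq_bot_of_not_le hlen hN.1 (h α hN)

theorem squareIdeal_eq_sumL (hlen : S.IsMaximalLength) (hann : S.lieAnnihilator = ⊥) :
    S.squareIdeal = S.sumL S.rootsJ := by
  refine le_antisymm ((le_sumL_of_not_le hlen hann isIdeal_squareIdeal fun α hα hle => ?_).trans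
    (biSup_mono fun α hα => hα.1)) (iSup₂_le fun α hα => hα.2)
  exact notMem_rootsNotJ_of_mem_rootsJ ⟨hα.1, hle⟩ hα

theorem squareIdeal_ne_top [Nontrivial L] (hperf : S.IsPerfect) : S.squareIdeal ≠ ⊤ := by
  intro h
  have h0 : S.prod ⊤ ⊤ = ⊥ := prod_eq_bot_iff.2 fun x _ y _ =>
    bracket_eq_zero_of_mem_squareIdeal x (h ▸ Submodule.mem_top)
  exact bot_ne_top (h0.symm.trans hperf)

/-! ### Connections of roots -/

theorem partialSum_succ (a : ℕ → Module.Dual K S.H) {i : ℕ} (hi : 1 ≤ i) :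
    S.partialSum a (i + 1) = S.shift (S.partialSum a i + a (i + 1)) := by
  obtain ⟨n, rfl⟩ := Nat.exists_eq_add_of_le' hi
  unfold partialSum
  rw [Finset.sum_Icc_succ_top (by omega), shift_add, shift_add, shift_sum,
    ← Function.iterate_succ_apply' S.shift, ← add_assoc, Nat.sub_self]
  refine congrArg₂ _ (congrArg₂ _ rfl (Finset.sum_congr rfl fun j hj => ?_)) rfl
  rw [Finset.mem_Icc] at hj
  rw [← Function.iterate_succ_apply' S.shift, Nat.succ_eq_add_one,
    Nat.sub_add_comm (show j ≤ n + 1 from hj.2)]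

theorem partialSum_one (a : ℕ → Module.Dual K S.H) : S.partialSum a 1 = a 1 := by
  simp [partialSum]

theorem partialSum_congr {a b : ℕ → Module.Dual K S.H} {i : ℕ} (hi : 1 ≤ i)
    (h : ∀ j ∈ Finset.Icc 1 i, a j = b j) : S.partialSum a i = S.partialSum b i := by
  induction i, hi using Nat.le_induction with
  | base => simpa [partialSum_one] using h 1
  | succ i hi ih =>
    rw [partialSum_succ a hi, partialSum_succ b hi, ih fun j hj => h j ?_, h (i + 1) (by simp)]
    rw [Finset.mem_Icc] at hj ⊢
    omega

theorem partialSum_shift (a : ℕ → Module.Dual K S.H) {i : ℕ} (hi : 1 ≤ i) :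
    S.partialSum (fun j => S.shift (a j)) i = S.shift (S.partialSum a i) := by
  induction i, hi using Nat.le_induction with
  | base => simp [partialSum_one]
  | succ i hi ih => rw [partialSum_succ _ hi, partialSum_succ _ hi, ih, ← shift_add]

/-- A property of roots which is invariant under `α ↦ α φ⁻¹` and propagates along the steps of
connections holds for one of `β`, `-β` if it holds for a root connected to `β`. -/
theorem IsNotJConnected.rec_on_steps {Γ : Set (Module.Dual K S.H)} {P : Module.Dual K S.H → Prop}
    (hshift : ∀ β, P (S.shift β) ↔ P β)
    (hstep : ∀ β a, β ∈ Γ → a ∈ S.rootsNotJ → S.shift (β + a) ∈ Γ → P β → P (S.shift (β + a)))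
    {α β : Module.Dual K S.H} (hαβ : S.IsNotJConnected Γ α β) (hα : P α) : P β ∨ P (-β) := by
  obtain ⟨k, a, hk, ha, hs, ⟨n, hn⟩, m, hm⟩ := hαβ
  have hiter : ∀ (n : ℕ) β, P (S.shift^[n] β) ↔ P β := by
    intro n
    induction n with
    | zero => exact fun _ => Iff.rfl
    | succ n ih => intro β; rw [Function.iterate_succ_apply, ih, hshift]
  have key : ∀ i, 1 ≤ i → i ≤ k → P (S.partialSum a i) := by
    intro i hi
    induction i, hi using Nat.le_induction with
    | base => intro _; rw [partialSum_one, hn, hiter]; exact hα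
    | succ i hi ih =>
      intro hik
      have hmem := hs (i + 1) (Finset.mem_Icc.2 ⟨by omega, hik⟩)
      rw [partialSum_succ a hi] at hmem ⊢
      exact hstep _ _ (hs i (Finset.mem_Icc.2 ⟨hi, by omega⟩))
        (ha _ (Finset.mem_Icc.2 ⟨by omega, hik⟩)) hmem (ih (by omega))
  have hP := key k hk le_rfl
  rcases hm with hm | hm
  · rw [hm, hiter] at hP
    exact .inl hP
  · rw [hm, ← shift_iterate_neg, hiter] at hP
    exact .inr hP

theorem IsNotJConnected.refl {Γ : Set (Module.Dual K S.H)} {α : Module.Dual K S.H} (hα : α ∈ Γ) :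
    S.IsNotJConnected Γ α α := by
  refine ⟨1, fun _ => α, le_rfl, fun i hi => ?_, fun i hi => ?_, ⟨0, rfl⟩, 0, .inl ?_⟩
  · rw [Finset.mem_Icc] at hi
    omega
  · rw [Finset.Icc_self, Finset.mem_singleton] at hi
    rwa [hi, partialSum_one]
  · rw [partialSum_one]
    rfl

theorem IsNotJConnected.neg {Γ : Set (Module.Dual K S.H)} {α β : Module.Dual K S.H}
    (h : S.IsNotJConnected Γ α β) : S.IsNotJConnected Γ α (-β) := by
  obtain ⟨k, a, hk, ha, hs, hn, m, hm⟩ := h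
  refine ⟨k, a, hk, ha, hs, hn, m, ?_⟩
  rw [shift_iterate_neg, neg_neg]
  exact hm.symm

theorem isNotJConnected_shift_iff {Γ : Set (Module.Dual K S.H)} (hΓ : ∀ β ∈ Γ, S.shift β ∈ Γ)
    {α β : Module.Dual K S.H} :
    S.IsNotJConnected Γ α (S.shift β) ↔ S.IsNotJConnected Γ α β := by
  constructor
  · rintro ⟨k, a, hk, ha, hs, hn, m, hm⟩
    exact ⟨k, a, hk, ha, hs, hn, m + 1, by simpa only [Function.iterate_succ_apply] using hm⟩
  · rintro ⟨k, a, hk, ha, hs, ⟨n, hn⟩, m, hm⟩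
    refine ⟨k, fun j => S.shift (a j), hk, fun i hi => shift_mem_rootsNotJ_iff.2 (ha i hi),
      fun i hi => ?_, ⟨n + 1, ?_⟩, m, ?_⟩
    · rw [partialSum_shift a (Finset.mem_Icc.1 hi).1]
      exact hΓ _ (hs i hi)
    · rw [Function.iterate_succ_apply', ← hn]
    · rw [partialSum_shift a hk, ← Function.iterate_succ_apply, Function.iterate_succ_apply',
        ← shift_neg, S.shift_injective.eq_iff, S.shift_injective.eq_iff]
      exact hm

theorem IsNotJConnected.step {Γ : Set (Module.Dual K S.H)} (hΓ : ∀ β ∈ Γ, S.shift β ∈ Γ)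
    (hΓn : S.IsSymmetric Γ) (hnJ : S.IsSymmetric S.rootsNotJ) {α β a : Module.Dual K S.H}
    (h : S.IsNotJConnected Γ α β) (ha : a ∈ S.rootsNotJ) (hβa : S.shift (β + a) ∈ Γ) :
    S.IsNotJConnected Γ α (S.shift (β + a)) := by
  obtain ⟨k, b, hk, hb, hs, hn, m, hm⟩ := h
  have hΓi : ∀ (m : ℕ), ∀ β ∈ Γ, S.shift^[m] β ∈ Γ := fun m β hβ =>
    Set.MapsTo.iterate (f := S.shift) hΓ m hβ
  have hai : S.shift^[m] a ∈ S.rootsNotJ :=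
    Set.MapsTo.iterate (f := S.shift) (fun β hβ => shift_mem_rootsNotJ_iff.2 hβ) m ha
  -- the new step adds `a φ⁻ᵐ` with the sign with which the given connection reaches `β φ⁻ᵐ`
  obtain ⟨c, hc, hcs⟩ : ∃ c ∈ S.rootsNotJ,
      S.shift (S.partialSum b k + c) = S.shift^[m] (S.shift (β + a)) ∨
      S.shift (S.partialSum b k + c) = -S.shift^[m] (S.shift (β + a)) := by
    rw [← Function.iterate_succ_apply, Function.iterate_succ_apply', shift_iterate_add]
    rcases hm with hm | hm
    · exact ⟨_, hai, .inl (by rw [hm])⟩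
    · exact ⟨_, hnJ _ hai, .inr (by rw [hm, ← neg_add, shift_neg])⟩
  have hcong : ∀ i ∈ Finset.Icc 1 k,
      S.partialSum (Function.update b (k + 1) c) i = S.partialSum b i := by
    intro i hi
    rw [Finset.mem_Icc] at hi
    refine partialSum_congr hi.1 fun j hj => Function.update_of_ne ?_ _ _
    rw [Finset.mem_Icc] at hj
    omega
  have hlast : S.partialSum (Function.update b (k + 1) c) (k + 1) =
      S.shift (S.partialSum b k + c) := by
    rw [partialSum_succ _ hk, hcong k (by simp [hk]), Function.update_self]
  refine ⟨k + 1, Function.update b (k + 1) c, by omega, fun i hi => ?_, fun i hi => ?_, ?_, m, ?_⟩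
  · rw [Finset.mem_Icc] at hi
    rcases eq_or_ne i (k + 1) with rfl | hne
    · simpa using hc
    · rw [Function.update_of_ne hne]
      exact hb i (Finset.mem_Icc.2 (by omega))
  · rw [Finset.mem_Icc] at hi
    rcases eq_or_ne i (k + 1) with rfl | hne
    · rw [hlast]
      rcases hcs with h | h
      · exact h ▸ hΓi m _ hβa
      · exact h ▸ hΓn _ (hΓi m _ hβa)
    · have hi' : i ∈ Finset.Icc 1 k := Finset.mem_Icc.2 (by omega)
      rw [hcong i hi']
      exact hs i hi'
  · rwa [Function.update_of_ne (by omega)]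
  · rwa [hlast]

/-! ### Ideals attached to unions of connection classes -/

theorem mem_rootsJ_of_mem_squareIdeal (hlen : S.IsMaximalLength) (hann : S.lieAnnihilator = ⊥)
    {α : Module.Dual K S.H} {v : L} (hv : v ∈ S.L_ α) (hvJ : v ∈ S.squareIdeal) (h0 : v ≠ 0) :
    α ∈ S.rootsJ := by
  by_contra hα
  rw [squareIdeal_eq_sumL hlen hann] at hvJ
  exact h0 (Submodule.disjoint_def.1 (disjoint_L_sumL hα) v hv hvJ)

theorem span_eq_sumL (C : Set (Module.Dual K S.H)) :
    Submodule.span K {v | ∃ α ∈ C, v ∈ S.L_ α} = S.sumL C := by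
  refine le_antisymm (Submodule.span_le.2 ?_) (iSup₂_le fun α hα v hv =>
    Submodule.subset_span ⟨α, hα, hv⟩)
  rintro v ⟨α, hα, hv⟩
  exact L_le_sumL hα hv

theorem symm_mem_L {α : Module.Dual K S.H} {v : L} (hv : v ∈ S.L_ (S.shift α)) :
    S.twist.symm v ∈ S.L_ α := by
  rw [← twist_mem_L_iff]
  simpa using hv

theorem isIdeal_sumL (hlen : S.IsMaximalLength) (hann : S.lieAnnihilator = ⊥)
    {C : Set (Module.Dual K S.H)} (hC : C ⊆ S.rootsJ) (hshift : ∀ β, S.shift β ∈ C ↔ β ∈ C)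
    (hstep : ∀ β ∈ C, ∀ a ∈ S.rootsNotJ, S.shift (β + a) ∈ S.rootsJ → S.shift (β + a) ∈ C) :
    S.IsIdeal (S.sumL C) := by
  rw [← span_eq_sumL]
  refine isIdeal_span ?_ ?_ ?_ <;> rw [span_eq_sumL]
  · rintro g ⟨γ, hγ, hg⟩ α v hv
    have hgJ : g ∈ S.squareIdeal := (hC hγ).2 hg
    rw [bracket_eq_zero_of_mem_squareIdeal v hgJ]
    refine ⟨?_, zero_mem _⟩
    by_cases h0 : S.bracket g v = 0
    · rw [h0]
      exact zero_mem _
    have hmem := bracket_mem_L hg hv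
    have hJ := mem_rootsJ_of_mem_squareIdeal hlen hann hmem
      (isIdeal_squareIdeal.bracket_left hgJ v) h0
    refine L_le_sumL ?_ hmem
    rcases L_cases hlen (α := α) with h | rfl | h | h
    · rw [h, Submodule.mem_bot] at hv
      exact absurd (by rw [hv, map_zero]) h0
    · rwa [add_zero, hshift]
    · exact absurd (bracket_eq_zero_of_mem_squareIdeal g (h.2 hv)) h0
    · exact hstep γ hγ α h hJ
  · rintro g ⟨γ, hγ, hg⟩
    exact L_le_sumL ((hshift γ).2 hγ) (twist_mem_L_iff.2 hg)
  · rintro g ⟨γ, hγ, hg⟩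
    obtain ⟨γ, rfl⟩ := S.shift_surjective γ
    exact L_le_sumL ((hshift γ).1 hγ) (symm_mem_L hg)

/-- For a union `C` of connection classes in `Λ^{¬J}`, the root spaces `L_β`, `β ∈ C`, together with
`J` and the products `[L_β, L_{-β}] ⊆ H` span an ideal, which contains no root space `L_α` with
`α ∈ Λ^{¬J} \ C`. -/
theorem exists_isIdeal (hlen : S.IsMaximalLength) (hann : S.lieAnnihilator = ⊥)
    (hnJ : S.IsSymmetric S.rootsNotJ) {C : Set (Module.Dual K S.H)} (hC : C ⊆ S.rootsNotJ)
    (hshift : ∀ β, S.shift β ∈ C ↔ β ∈ C) (hneg : S.IsSymmetric C)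
    (hstep : ∀ β ∈ C, ∀ a ∈ S.rootsNotJ, S.shift (β + a) ∈ S.rootsNotJ → S.shift (β + a) ∈ C) :
    ∃ I, S.IsIdeal I ∧ (∀ β ∈ C, S.L_ β ≤ I) ∧ I ≤ S.sumL (insert 0 (C ∪ S.rootsJ)) := by
  have hJI := isIdeal_squareIdeal (A := S.toRegularHomLeibniz)
  let G : Set L := {v | ∃ β ∈ C, v ∈ S.L_ β} ∪
    ({v | ∃ β ∈ C, ∃ x ∈ S.L_ β, ∃ y ∈ S.L_ (-β), S.bracket x y = v} ∪ S.squareIdeal)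
  have hGL : ∀ β ∈ C, S.L_ β ≤ Submodule.span K G := fun β hβ v hv =>
    Submodule.subset_span (.inl ⟨β, hβ, hv⟩)
  have hGH : ∀ β ∈ C, ∀ x ∈ S.L_ β, ∀ y ∈ S.L_ (-β), S.bracket x y ∈ Submodule.span K G :=
    fun β hβ x hx y hy => Submodule.subset_span (.inr (.inl ⟨β, hβ, x, hx, y, hy, rfl⟩))
  have hGJ : S.squareIdeal ≤ Submodule.span K G := fun v hv =>
    Submodule.subset_span (.inr (.inr hv))
  have hL : ∀ β ∈ C, ∀ x ∈ S.L_ β, ∀ α, ∀ v ∈ S.L_ α,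
      S.bracket x v ∈ Submodule.span K G ∧ S.bracket v x ∈ Submodule.span K G := by
    intro β hβ x hx α v hv
    have h1 := bracket_mem_L hx hv
    have h2 := bracket_mem_L hv hx
    rw [add_comm α β] at h2
    rcases L_cases hlen (α := α) with h | rfl | h | h
    · rw [h, Submodule.mem_bot] at hv
      simp [hv]
    · rw [add_zero] at h1 h2
      exact ⟨hGL _ ((hshift β).2 hβ) h1, hGL _ ((hshift β).2 hβ) h2⟩
    · exact ⟨hGJ (hJI.bracket_right (h.2 hv) x), hGJ (hJI.bracket_left (h.2 hv) x)⟩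
    · rcases L_cases hlen (α := S.shift (β + α)) with h' | h' | h' | h'
      · rw [h', Submodule.mem_bot] at h1 h2
        simp [h1, h2]
      · rw [shift_eq_zero_iff, add_eq_zero_iff_neg_eq] at h'
        subst h'
        exact ⟨hGH β hβ x hx v hv, hGH (-β) (hneg β hβ) v hv x (by rwa [neg_neg])⟩
      · exact ⟨hGJ (h'.2 h1), hGJ (h'.2 h2)⟩
      · exact ⟨hGL _ (hstep β hβ α h h') h1, hGL _ (hstep β hβ α h h') h2⟩
  -- a step that joins a root in `C` and a root outside `C` cannot end in `Λ^{¬J}`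
  have hout : ∀ β ∈ C, ∀ α ∈ S.rootsNotJ, α ∉ C → ∀ x ∈ S.L_ β, ∀ z ∈ S.L_ α,
      S.bracket x z ∈ S.squareIdeal := by
    intro β hβ α hα hαC x hx z hz
    have h1 := bracket_mem_L hx hz
    rcases L_cases hlen (α := S.shift (β + α)) with h' | h' | h' | h'
    · rw [h', Submodule.mem_bot] at h1
      rw [h1]
      exact zero_mem _
    · rw [shift_eq_zero_iff, add_eq_zero_iff_neg_eq] at h'
      exact absurd (h' ▸ hneg β hβ) hαC
    · exact h'.2 h1
    · have hback : S.shift (S.shift (β + α) + -S.shift β) = S.shift (S.shift α) := by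
        rw [shift_add S β α, add_neg_cancel_comm]
      have := hstep _ (hstep β hβ α hα h') (-S.shift β)
        (hnJ _ (shift_mem_rootsNotJ_iff.2 (hC hβ)))
        (by rwa [hback, shift_mem_rootsNotJ_iff, shift_mem_rootsNotJ_iff])
      rw [hback, hshift, hshift] at this
      exact absurd this hαC
  refine ⟨Submodule.span K G, isIdeal_span ?_ ?_ ?_, hGL, Submodule.span_le.2 ?_⟩
  · rintro g (⟨β, hβ, hg⟩ | ⟨β, hβ, x, hx, y, hy, rfl⟩ | hg) α v hv
    · exact hL β hβ g hg α v hv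
    · have hH : S.bracket x y ∈ S.L_ 0 := by
        simpa [shift_zero] using bracket_mem_L hx hy
      rcases L_cases hlen (α := α) with h | rfl | h | h
      · rw [h, Submodule.mem_bot] at hv
        simp [hv]
      · rw [L_zero] at hH hv
        simp [bracket_eq_zero_of_mem_H hH hv, bracket_eq_zero_of_mem_H hv hH]
      · exact ⟨hGJ (hJI.bracket_right (h.2 hv) _), hGJ (hJI.bracket_left (h.2 hv) _)⟩
      · by_cases hαC : α ∈ C
        · exact (hL α hαC v hv 0 _ hH).symm
        obtain ⟨α, rfl⟩ := S.shift_surjective α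
        obtain ⟨z, rfl⟩ := S.twist.surjective v
        rw [twist_mem_L_iff] at hv
        rw [shift_mem_rootsNotJ_iff] at h
        rw [hshift] at hαC
        have hmem : S.bracket (S.bracket x y) (S.twist z) ∈ S.squareIdeal := by
          rw [S.hom_leibniz]
          exact add_mem (hJI.bracket_left (hout β hβ α h hαC x hx z hv) _)
            (hJI.bracket_right (hout (-β) (hneg β hβ) α h hαC y hy z hv) _)
        exact ⟨hGJ hmem, hGJ ((S.squareIdeal.add_mem_iff_right hmem).1
          (bracket_add_swap_mem_squareIdeal _ _))⟩
    · exact ⟨hGJ (hJI.bracket_left hg v), hGJ (hJI.bracket_right hg v)⟩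
  · rintro g (⟨β, hβ, hg⟩ | ⟨β, hβ, x, hx, y, hy, rfl⟩ | hg)
    · exact hGL _ ((hshift β).2 hβ) (twist_mem_L_iff.2 hg)
    · rw [S.twist_bracket]
      refine hGH _ ((hshift β).2 hβ) _ (twist_mem_L_iff.2 hx) _ ?_
      rw [← shift_neg]
      exact twist_mem_L_iff.2 hy
    · exact hGJ (hJI.twist_mem_iff.2 hg)
  · rintro g (⟨β, hβ, hg⟩ | ⟨β, hβ, x, hx, y, hy, rfl⟩ | hg)
    · obtain ⟨β, rfl⟩ := S.shift_surjective β
      exact hGL _ ((hshift β).1 hβ) (symm_mem_L hg)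
    · obtain ⟨β, rfl⟩ := S.shift_surjective β
      rw [← shift_neg] at hy
      have := hGH _ ((hshift β).1 hβ) _ (symm_mem_L hx) _ (symm_mem_L hy)
      convert this using 1
      rw [LinearEquiv.symm_apply_eq, S.twist_bracket]
      simp
    · exact hGJ (hJI.twist_mem_iff.1 (by simpa using hg))
  · rintro g (⟨β, hβ, hg⟩ | ⟨β, hβ, x, hx, y, hy, rfl⟩ | hg)
    · exact L_le_sumL (.inr (.inl hβ)) hg
    · refine L_le_sumL (.inl rfl) ?_
      simpa [shift_zero] using bracket_mem_L hx hy
    · have hle : S.sumL S.rootsJ ≤ S.sumL (insert 0 (C ∪ S.rootsJ)) :=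
        biSup_mono fun α hα => .inr (.inr hα)
      exact hle ((squareIdeal_eq_sumL hlen hann).le hg)

/-! ### Simplicity -/

/-- As `L = [L, L]`, the subspace `H` is the sum of the products `[L_γ, L_{-γ}]`, and only those
with `γ ∈ Λ^{¬J}` can be nonzero. So an ideal containing a factor of each of these contains `H`,
hence everything. -/
theorem eq_top_of_forall_L_le_or (hlen : S.IsMaximalLength) (hperf : S.IsPerfect)
    (hJ : S.IsSymmetric S.rootsJ) {I : Submodule K L} (hI : S.IsIdeal I)
    (h : ∀ γ ∈ S.rootsNotJ, S.L_ γ ≤ I ∨ S.L_ (-γ) ≤ I) : I = ⊤ := by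
  have hprod : ∀ α, ∀ v ∈ S.L_ α, ∀ β, ∀ w ∈ S.L_ β,
      S.bracket v w ∈ I ⊔ S.sumL {α | α ≠ 0} := by
    intro α v hv β w hw
    by_cases h0 : α + β = 0
    · refine Submodule.mem_sup_left ?_
      rw [add_eq_zero_iff_neg_eq] at h0
      subst h0
      rcases L_cases hlen (α := α) with h' | rfl | h' | h'
      · rw [h', Submodule.mem_bot] at hv
        simp [hv]
      · rw [neg_zero] at hw
        rw [L_zero] at hv hw
        rw [bracket_eq_zero_of_mem_H hv hw]
        exact zero_mem _
      · rw [bracket_eq_zero_of_mem_squareIdeal v ((hJ α h').2 hw)]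
        exact zero_mem _
      · exact (h α h').elim (fun h' => hI.bracket_left (h' hv) w)
          (fun h' => hI.bracket_right (h' hw) v)
    · exact Submodule.mem_sup_right (L_le_sumL (S.shift_eq_zero_iff.not.2 h0) (bracket_mem_L hv hw))
  have htop : I ⊔ S.sumL {α | α ≠ 0} = ⊤ := by
    rw [eq_top_iff]
    refine hperf.ge.trans (Submodule.map₂_le.2 fun x _ y _ => ?_)
    have h1 : ∀ α, ∀ v ∈ S.L_ α, ∀ y, S.bracket v y ∈ I ⊔ S.sumL {α | α ≠ 0} := by
      intro α v hv y
      have := eq_top_of_forall_L_le (S := S) (P := (I ⊔ S.sumL {α | α ≠ 0}).comap (S.bracket v))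
        fun β w hw => hprod α v hv β w hw
      exact this.ge (Submodule.mem_top (x := y))
    have := eq_top_of_forall_L_le (S := S) (P := (I ⊔ S.sumL {α | α ≠ 0}).comap (S.bracket.flip y))
      fun α v hv => h1 α v hv y
    exact this.ge (Submodule.mem_top (x := x))
  have hH : S.H ≤ I := by
    intro x hx
    obtain ⟨i, hi, w, hw, rfl⟩ := Submodule.mem_sup.1 (htop.ge (Submodule.mem_top (x := x)))
    refine mem_of_add_mem (fun x hx h _ => hI.bracket_left hx h) (fun x => hI.twist_mem_iff)
      (Γ := {α | α ≠ 0}) (α := 0) (by simp) (mem_L_zero_of_mem_H hx) (neg_mem hw) ?_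
    simpa using hi
  refine eq_top_of_forall_L_le (S := S) fun α v hv => ?_
  by_cases h0 : α = 0
  · subst h0
    exact hH (L_zero.le hv)
  · obtain ⟨x, hx⟩ := DFunLike.ne_iff.1 h0
    have := hI.bracket_right (hH x.2) v
    rw [hv x] at this
    exact hI.twist_mem_iff.1 ((I.smul_mem_iff hx).1 this)

theorem allNotJConnected_rootsJ [Nontrivial L] (hlen : S.IsMaximalLength) (hperf : S.IsPerfect)
    (hann : S.lieAnnihilator = ⊥) (hJ : S.IsSymmetric S.rootsJ)
    (hnJ : S.IsSymmetric S.rootsNotJ) (hS : S.IsSimple) : S.AllNotJConnected S.rootsJ := by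
  intro α hα β hβ
  have hs : ∀ β ∈ S.rootsJ, S.shift β ∈ S.rootsJ := fun β => shift_mem_rootsJ_iff.2
  have hI := isIdeal_sumL hlen hann (C := {β | β ∈ S.rootsJ ∧ S.IsNotJConnected S.rootsJ α β})
    (fun β hβ => hβ.1) (fun β => and_congr shift_mem_rootsJ_iff (isNotJConnected_shift_iff hs))
    (fun β hβ a ha h => ⟨h, hβ.2.step hs hJ hnJ ha h⟩)
  by_contra hc
  have hαI := L_le_sumL (S := S) (Γ := {β | β ∈ S.rootsJ ∧ S.IsNotJConnected S.rootsJ α β})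
    ⟨hα, .refl hα⟩
  rcases hS.2 _ hI with h | h | h
  · exact hα.1.2 (le_bot_iff.1 (hαI.trans h.le))
  · refine hβ.1.2 ((disjoint_L_sumL fun h => hc h.2).eq_bot_of_le (hβ.2.trans h.ge))
  · refine squareIdeal_ne_top hperf (top_le_iff.1 (h.ge.trans ?_))
    exact iSup₂_le fun γ hγ => hγ.1.2

theorem allNotJConnected_rootsNotJ (hlen : S.IsMaximalLength) (hann : S.lieAnnihilator = ⊥)
    (hnJ : S.IsSymmetric S.rootsNotJ) (hS : S.IsSimple) : S.AllNotJConnected S.rootsNotJ := by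
  intro α hα β hβ
  have hs : ∀ β ∈ S.rootsNotJ, S.shift β ∈ S.rootsNotJ := fun β => shift_mem_rootsNotJ_iff.2
  obtain ⟨I, hI, hCI, hIle⟩ := exists_isIdeal hlen hann hnJ
    (C := {β | β ∈ S.rootsNotJ ∧ S.IsNotJConnected S.rootsNotJ α β})
    (fun β hβ => hβ.1) (fun β => and_congr shift_mem_rootsNotJ_iff (isNotJConnected_shift_iff hs))
    (fun β hβ => ⟨hnJ β hβ.1, hβ.2.neg⟩)
    (fun β hβ a ha h => ⟨h, hβ.2.step hs hnJ hnJ ha h⟩)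
  have hαI := hCI α ⟨hα, .refl hα⟩
  rcases hS.2 I hI with h | h | h
  · exact absurd (le_bot_iff.1 (hαI.trans h.le)) hα.1.2
  · exact absurd ((inf_eq_left.2 (hαI.trans h.le)).symm.trans hα.2) hα.1.2
  · by_contra hc
    refine hβ.1.2 ((disjoint_L_sumL ?_).eq_bot_of_le ((le_top.trans h.ge).trans hIle))
    rintro (h0 | h' | h')
    · exact hβ.1.1 h0
    · exact hc h'.2
    · exact notMem_rootsNotJ_of_mem_rootsJ h' hβ

theorem eq_top_of_L_le (hlen : S.IsMaximalLength) (hperf : S.IsPerfect)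
    (hmult : S.IsRootMultiplicative) (hJ : S.IsSymmetric S.rootsJ)
    (hcon : S.AllNotJConnected S.rootsNotJ) {I : Submodule K L} (hI : S.IsIdeal I)
    {α : Module.Dual K S.H} (hα : α ∈ S.rootsNotJ) (hαI : S.L_ α ≤ I) : I = ⊤ := by
  refine eq_top_of_forall_L_le_or hlen hperf hJ hI fun γ hγ => ?_
  refine (hcon α hα γ hγ).rec_on_steps (P := fun β => S.L_ β ≤ I)
    (L_le_iff fun x => hI.twist_mem_iff) (fun β a hβ ha h hβI => ?_) hαI
  exact L_shift_add_le hlen hI hβI h.1 (hmult.1 β hβ a ha (shift_add S β a ▸ h.1))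

/-- For an ideal `I ⊆ J`, the root spaces of `J` that are not in `I` span an ideal `M` as well: a
product of `L_β` falling into `I` could be multiplied back into a shift of `L_β`. As `[L, J] = 0`,
the ideals `I` and `M` annihilate each other, and primeness applies to them. -/
theorem eq_bot_or_eq_squareIdeal [Nontrivial L] (hlen : S.IsMaximalLength)
    (hperf : S.IsPerfect) (hann : S.lieAnnihilator = ⊥) (hmult : S.IsRootMultiplicative)
    (hnJ : S.IsSymmetric S.rootsNotJ) (hS : S.IsPrime) {I : Submodule K L} (hI : S.IsIdeal I)
    (hIJ : I ≤ S.squareIdeal) : I = ⊥ ∨ I = S.squareIdeal := by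
  have hnot : ∀ α ∈ S.rootsNotJ, ¬ S.L_ α ≤ I := fun α hα h =>
    notMem_rootsNotJ_of_mem_rootsJ ⟨hα.1, h.trans hIJ⟩ hα
  have hIle := le_sumL_of_not_le hlen hann hI hnot
  have hshift := L_le_iff (S := S) fun x => hI.twist_mem_iff
  set C := {δ | δ ∈ S.rootsJ ∧ ¬ S.L_ δ ≤ I}
  have hMJ : S.sumL C ≤ S.squareIdeal := iSup₂_le fun δ hδ => hδ.1.2
  have hM : S.IsIdeal (S.sumL C) := by
    refine isIdeal_sumL hlen hann (fun δ hδ => hδ.1)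
      (fun β => and_congr shift_mem_rootsJ_iff (hshift β).not)
      fun β hβ a ha h => ⟨h, fun hle => hβ.2 ?_⟩
    have hback : S.shift (S.shift (β + a) + -S.shift a) = S.shift (S.shift β) := by
      rw [shift_add S β a, add_neg_cancel_right]
    have hmem : S.shift (S.shift (β + a) + -S.shift a) ∈ S.rootsJ := by
      rw [hback, shift_mem_rootsJ_iff, shift_mem_rootsJ_iff]
      exact hβ.1
    have h1 := hnJ _ (shift_mem_rootsNotJ_iff.2 ha)
    have := L_shift_add_le hlen hI hle hmem.1
      (hmult.2 _ h1 _ h (by rwa [add_comm, ← shift_add]))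
    rwa [hback, hshift, hshift] at this
  have hzero : S.prod I (S.sumL C) ⊔ S.prod (S.sumL C) I = ⊥ :=
    sup_eq_bot_iff.2 ⟨prod_eq_bot_iff.2 fun x _ y hy => bracket_eq_zero_of_mem_squareIdeal x (hMJ hy),
      prod_eq_bot_iff.2 fun x _ y hy => bracket_eq_zero_of_mem_squareIdeal x (hIJ hy)⟩
  have hJtop := squareIdeal_ne_top hperf
  rcases hS I _ hI hM hzero with (h | h | h) | (h | h | h)
  · exact .inl h
  · exact .inr h
  · exact absurd (top_le_iff.1 (h.ge.trans hIJ)) hJtop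
  · refine .inr (le_antisymm hIJ ?_)
    rw [squareIdeal_eq_sumL hlen hann]
    refine iSup₂_le fun δ hδ => ?_
    by_contra hc
    exact hδ.1.2 (le_bot_iff.1 ((L_le_sumL (S := S) (Γ := C) ⟨hδ, hc⟩).trans h.le))
  · refine .inl (le_bot_iff.1 (hIle.trans (iSup₂_le fun δ hδ => ?_)))
    exact ((disjoint_L_sumL fun h' => h'.2 hδ.2).eq_bot_of_le (hδ.1.2.trans h.ge)).le
  · exact absurd (top_le_iff.1 (h.ge.trans hMJ)) hJtop

end SplitRegularHomLeibniz

theorem mainTheorem4 {K L : Type*} [Field K] [CharZero K] [AddCommGroup L] [Module K L]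
    [Nontrivial L] (S : SplitRegularHomLeibniz K L)
    (hlen : S.IsMaximalLength)
    (hperf : S.IsPerfect)
    (hann : S.lieAnnihilator = ⊥)
    (hmult : S.IsRootMultiplicative)
    (hJ : S.IsSymmetric S.rootsJ)
    (hnJ : S.IsSymmetric S.rootsNotJ) :
    S.IsSimple ↔
      (S.IsPrime ∧ S.AllNotJConnected S.rootsJ ∧ S.AllNotJConnected S.rootsNotJ) := by
  refine ⟨fun hS => ⟨fun I _ hI _ _ => .inl (hS.2 I hI),
    SplitRegularHomLeibniz.allNotJConnected_rootsJ hlen hperf hann hJ hnJ hS,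
    SplitRegularHomLeibniz.allNotJConnected_rootsNotJ hlen hann hnJ hS⟩, ?_⟩
  rintro ⟨hP, -, hcon⟩
  refine ⟨?_, fun I hI => ?_⟩
  · by_contra! h
    exact bot_ne_top ((RegularHomLeibniz.prod_eq_bot_iff.2 fun x _ y _ => h x y).symm.trans hperf)
  · by_cases h : ∃ α ∈ S.rootsNotJ, S.L_ α ≤ I
    · obtain ⟨α, hα, hαI⟩ := h
      exact .inr (.inr (SplitRegularHomLeibniz.eq_top_of_L_le hlen hperf hmult hJ hcon hI hα hαI))
    · push Not at h
      have hIJ : I ≤ S.squareIdeal :=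
        (SplitRegularHomLeibniz.le_sumL_of_not_le hlen hann hI h).trans (iSup₂_le fun α hα => hα.1.2)
      exact (SplitRegularHomLeibniz.eq_bot_or_eq_squareIdeal hlen hperf hann hmult hnJ hP hI hIJ).imp_right .inl
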